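/- Consider a hybrid inclusion $\mathcal H=(C,F,D,G)$ on $\mathbb R^n$: $\dot x\in F(x)$ while $x\in C$, and $x^+\in G(x)$ while $x\in D$, where $C,D\subset\mathbb R^n$ and $F,G:\mathbb R^n\rightrightarrows\mathbb R^n$ are set-valued maps. A hybrid time domain is a set $E\subset\mathbb R_{\ge 0}\times\mathbb N$ that is totally ordered by the product order and such that, for each $(T,J)\in E$, $E\cap([0,T]\times\{0,\dots,J\})=\bigcup_{j=0}^{J}[t_j,t_{j+1}]\times\{j\}$ for some $0=t_0\le t_1\le\dots\le t_{J+1}$. A solution is a function $x$ on a hybrid time domain $\operatorname{dom}x\ni(0,0)$, with $t\mapsto x(t,j)$ absolutely continuous on each compact subinterval of $I^j=\{t:(t,j)\in\operatorname{dom}x\}$, such that $x(0,0)\in\operatorname{cl}(C)\cup D$; for each $j$ for which $I^j$ has nonempty interior, $x(t,j)\in C$ for all $t\in\operatorname{int}I^j$ and $\dot x(t,j)\in F(x(t,j))$ for almost all $t\in I^j$; and $x(t,j)\in D$, $x(t,j+1)\in G(x(t,j))$ whenever $(t,j),(t,j+1)\in\operatorname{dom}x$. It is maximal if it is not the restriction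 of a solution with a strictly larger domain, and complete if $\operatorname{dom}x$ is unbounded. Let $K\subset C\cup D$ be closed. Assume that $F$ is outer semicontinuous relative to $C$ on $C$, locally bounded relative to $C$ at every point of $C$ and of $K\cap\partial C$, and has nonempty convex values on $C$, and that $G(x)\neq\emptyset$ for all $x\in D$. Suppose that: 1. $K$ is forward pre-invariant: every maximal solution $x$ with $x(0,0)\in K$ satisfies $x(t,j)\in K$ for all $(t,j)\in\operatorname{dom}x$; 2. no solution starting from $K$ escapes in finite time inside $K\cap C$; that is, there are no solution $x$ with $x(0,0)\in K$, $j\in\mathbb N$ and $s<T<\infty$ such that $[s,T)\times\{j\}\subset\operatorname{dom}x$, $x(t,j)\in K\cap C$ for all $t\in[s,T)$, and $|x(t,j)|\to\infty$ as $t\to T^-$; 3. from every $x_o\in(K\cap\partial C)\setminus D$ there is a nontrivial flow, that is, a solution $x$ with $x(0,0)=x_o$ and $[0,\varepsilon]\times\{0\}\subset\operatorname{dom}x$ for some $\varepsilon>0$. Then $K$ is forward invariant: it is forward pre-invariant, and every maximal solution starting from $K$ is complete. -/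

import Mathlib

open Set Filter Topology MeasureTheory

/-- The data `(C, F, D, G)` of a hybrid inclusion on `ℝⁿ`: while `x ∈ C` the state may flow
according to `ẋ ∈ F x`, and while `x ∈ D` it may jump according to `x⁺ ∈ G x`. -/
structure HybridSystem (n : ℕ) where
  /-- flow set -/
  C : Set (EuclideanSpace ℝ (Fin n))
  /-- flow map -/
  F : EuclideanSpace ℝ (Fin n) → Set (EuclideanSpace ℝ (Fin n))
  /-- jump set -/
  D : Set (EuclideanSpace ℝ (Fin n))
  /-- jump map -/
  G : EuclideanSpace ℝ (Fin n) → Set (EuclideanSpace ℝ (Fin n))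

/-- Hybrid time domains: `E ⊆ ℝ≥0 × ℕ` such that for each `(T, J) ∈ E` the truncation
`E ∩ ([0, T] × {0, …, J})` is `⋃_{j ≤ J} [t j, t (j + 1)] × {j}` with
`0 = t 0 ≤ t 1 ≤ … ≤ t (J + 1)`. -/
structure IsHybridTimeDomain (E : Set (ℝ × ℕ)) : Prop where
  nonneg : ∀ p ∈ E, 0 ≤ p.1
  truncation : ∀ p ∈ E, ∃ t : ℕ → ℝ, t 0 = 0 ∧ (∀ j ≤ p.2, t j ≤ t (j + 1)) ∧
    E ∩ (Icc 0 p.1 ×ˢ Iic p.2) = {q : ℝ × ℕ | q.2 ≤ p.2 ∧ q.1 ∈ Icc (t q.2) (t (q.2 + 1))}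
  /-- Hybrid times are totally ordered, so that the domain does not branch: no domain both
  flows on beyond time `t` at level `j` and jumps to level `j + 1` at time `t`. -/
  chain : ∀ p ∈ E, ∀ q ∈ E, p ≤ q ∨ q ≤ p

/-- A function defined on a set of hybrid times. Only the values of `val` on `dom` matter. -/
structure HybridArc (n : ℕ) where
  /-- domain of definition -/
  dom : Set (ℝ × ℕ)
  /-- value at the hybrid time `(t, j)` -/
  val : ℝ → ℕ → EuclideanSpace ℝ (Fin n)

namespace HybridArc

variable {n : ℕ}

/-- The set `I^j = {t : (t, j) ∈ dom x}`. -/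
def flowInterval (x : HybridArc n) (j : ℕ) : Set ℝ := {t | (t, j) ∈ x.dom}

/-- The arc is complete: its hybrid time domain is unbounded. -/
def IsComplete (x : HybridArc n) : Prop := ¬ Bornology.IsBounded x.dom

/-- The arc escapes in finite time inside `S`: on some interval `[s, T) × {j}` of its domain,
with `T` finite, it flows inside `S` and its norm tends to infinity as `t → T⁻`. -/
def EscapesInFiniteTimeInside (x : HybridArc n) (S : Set (EuclideanSpace ℝ (Fin n))) : Prop :=
  ∃ (j : ℕ) (s T : ℝ), s < T ∧ (∀ t ∈ Ico s T, (t, j) ∈ x.dom ∧ x.val t j ∈ S) ∧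
    Tendsto (fun t => ‖x.val t j‖) (𝓝[<] T) atTop

end HybridArc

namespace HybridSystem

variable {n : ℕ}

/-- Solutions to a hybrid inclusion. -/
structure IsSolution (H : HybridSystem n) (x : HybridArc n) : Prop where
  isHybridTimeDomain : IsHybridTimeDomain x.dom
  zero_mem : ((0 : ℝ), (0 : ℕ)) ∈ x.dom
  /-- `t ↦ x(t, j)` is absolutely continuous on each compact subinterval of `I^j`. -/
  absolutelyContinuous : ∀ (j : ℕ) (a b : ℝ), a ∈ x.flowInterval j → b ∈ x.flowInterval j →
    AbsolutelyContinuousOnInterval (fun t => x.val t j) a b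
  init_mem : x.val 0 0 ∈ closure H.C ∪ H.D
  flow_mem : ∀ j : ℕ, (interior (x.flowInterval j)).Nonempty →
    ∀ t ∈ interior (x.flowInterval j), x.val t j ∈ H.C
  flow_deriv : ∀ j : ℕ, (interior (x.flowInterval j)).Nonempty →
    ∀ᵐ t : ℝ, t ∈ x.flowInterval j →
      ∃ v ∈ H.F (x.val t j), HasDerivAt (fun s => x.val s j) v t
  jump : ∀ (t : ℝ) (j : ℕ), (t, j) ∈ x.dom → (t, j + 1) ∈ x.dom →
    x.val t j ∈ H.D ∧ x.val t (j + 1) ∈ H.G (x.val t j)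

/-- Maximal solutions: those that no solution on a strictly larger domain extends. -/
def IsMaximalSolution (H : HybridSystem n) (x : HybridArc n) : Prop :=
  H.IsSolution x ∧ ¬ ∃ y : HybridArc n, H.IsSolution y ∧ x.dom ⊂ y.dom ∧
    ∀ p ∈ x.dom, x.val p.1 p.2 = y.val p.1 p.2

/-- Every maximal solution starting from `K` stays in `K`. -/
def IsForwardPreInvariant (H : HybridSystem n) (K : Set (EuclideanSpace ℝ (Fin n))) : Prop :=
  ∀ x : HybridArc n, H.IsMaximalSolution x → x.val 0 0 ∈ K → ∀ p ∈ x.dom, x.val p.1 p.2 ∈ K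

/-- Forward pre-invariance together with completeness of every maximal solution from `K`. -/
def IsForwardInvariant (H : HybridSystem n) (K : Set (EuclideanSpace ℝ (Fin n))) : Prop :=
  H.IsForwardPreInvariant K ∧
    ∀ x : HybridArc n, H.IsMaximalSolution x → x.val 0 0 ∈ K → x.IsComplete

/-- A nontrivial flow exists from `x₀`: some solution starting from `x₀` flows on `[0, ε]`
for some `ε > 0`. -/
def HasNontrivialFlowFrom (H : HybridSystem n) (x₀ : EuclideanSpace ℝ (Fin n)) : Prop :=
  ∃ x : HybridArc n, H.IsSolution x ∧ x.val 0 0 = x₀ ∧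
    ∃ ε : ℝ, 0 < ε ∧ ∀ t ∈ Icc 0 ε, (t, 0) ∈ x.dom

end HybridSystem

/-- Outer semicontinuity of the set-valued map `F` relative to `C`, at the points of `C`. -/
def OuterSemicontinuousOn {n : ℕ}
    (F : EuclideanSpace ℝ (Fin n) → Set (EuclideanSpace ℝ (Fin n)))
    (C : Set (EuclideanSpace ℝ (Fin n))) : Prop :=
  ∀ x ∈ C, ∀ (u v : ℕ → EuclideanSpace ℝ (Fin n)) (y : EuclideanSpace ℝ (Fin n)),
    (∀ i, u i ∈ C) → (∀ i, v i ∈ F (u i)) → Tendsto u atTop (𝓝 x) → Tendsto v atTop (𝓝 y) →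
      y ∈ F x

/-- Local boundedness, relative to `C`, of the set-valued map `F` at the point `x`. -/
def LocallyBoundedWithinAt {n : ℕ}
    (F : EuclideanSpace ℝ (Fin n) → Set (EuclideanSpace ℝ (Fin n)))
    (C : Set (EuclideanSpace ℝ (Fin n))) (x : EuclideanSpace ℝ (Fin n)) : Prop :=
  ∃ U ∈ 𝓝 x, ∃ M : ℝ, 0 < M ∧ ∀ y ∈ U ∩ C, ∀ ζ ∈ F y, ‖ζ‖ ≤ M

/-! Suppose a maximal solution from `K` has bounded domain. It has a last level `J`, and `I^J` has a
finite supremum `T`. Whether or not `T` is attained, the solution can be extended, contradicting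
maximality.

If `T` is attained, the endpoint is not in `D`, since `G` would supply a further jump
(`notMem_of_isGreatest`). By pre-invariance it is in `K`, hence in `C`. A flow then starts from it:
by local existence if it is interior to `C` (`exists_isFlowOn_of_mem_interior`), by the nontrivial
flow hypothesis if it lies on the boundary. Concatenation prolongs the solution (`IsFlowOn.concat`).

If `T` is not attained, the solution lies in `K ∩ C` just before `T`. Its norm does not tend to
infinity, so it accumulates at some `p` in the closed set `K ∩ closure C`, where `F` is locally
bounded. Bounded speed near `p` turns accumulation into convergence, so `T` can be added to the
domain with value `p` (`IsFlowOn.update_of_mapClusterPt`). The point `p` need not be in `C`, because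
solutions are constrained to `C` only at interior times.

Outer semicontinuity and convexity serve only local existence. Euler schemes for an arbitrary
bounded selection of `F` have a Lipschitz limit; its derivative is a limit of averages of nearby
values of `F`, hence belongs to the closed convex value of `F` at the limit. -/

/-! ### Absolutely continuous curves: gluing and the speed bound. -/

namespace AbsolutelyContinuousOnInterval

/-- Reparametrizing by a monotone nonexpansive map preserves absolute continuity. -/
theorem comp_monotone {X : Type*} [PseudoMetricSpace X] {f : ℝ → X} {φ : ℝ → ℝ} {a b c d : ℝ}
    (hf : AbsolutelyContinuousOnInterval f c d) (hφ : Monotone φ)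
    (hφ' : ∀ s t, dist (φ s) (φ t) ≤ dist s t) (hmaps : ∀ t ∈ uIcc a b, φ t ∈ uIcc c d) :
    AbsolutelyContinuousOnInterval (fun t => f (φ t)) a b := by
  rw [absolutelyContinuousOnInterval_iff] at hf ⊢
  intro ε hε
  obtain ⟨δ, hδ, h⟩ := hf ε hε
  refine ⟨δ, hδ, fun E hE hlen => ?_⟩
  refine h (E.1, fun i => (φ (E.2 i).1, φ (E.2 i).2)) ⟨fun i hi => ?_, ?_⟩ ?_
  · exact ⟨hmaps _ (hE.1 i hi).1, hmaps _ (hE.1 i hi).2⟩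
  · intro i hi j hj hij
    have hd := hE.2 hi hj hij
    simp only [Function.onFun, Set.disjoint_left, mem_uIoc] at hd ⊢
    -- If two image intervals share `z`, each left end precedes each right end before applying `φ`,
    -- so the smaller right end lies in both original intervals. The four cases are the possible
    -- orientations.
    have key : ∀ {x y z : ℝ}, φ x < z → z ≤ φ y → x < y := fun h1 h2 =>
      hφ.reflect_lt (h1.trans_le h2)
    rintro z (⟨h1, h2⟩ | ⟨h1, h2⟩) (⟨h3, h4⟩ | ⟨h3, h4⟩)
    all_goals
      have k1 := key h1 h2
      have k2 := key h1 h4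
      have k3 := key h3 h2
      have k4 := key h3 h4
    · exact hd (a := min (E.2 i).2 (E.2 j).2) (by grind) (by grind)
    · exact hd (a := min (E.2 i).2 (E.2 j).1) (by grind) (by grind)
    · exact hd (a := min (E.2 i).1 (E.2 j).2) (by grind) (by grind)
    · exact hd (a := min (E.2 i).1 (E.2 j).1) (by grind) (by grind)
  · exact (Finset.sum_le_sum fun i _ => hφ' _ _).trans_lt hlen

theorem comp_lipschitzWith {X Y : Type*} [PseudoMetricSpace X] [PseudoMetricSpace Y]
    {f : ℝ → X} {g : X → Y} {L : NNReal} {a b : ℝ}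
    (hg : LipschitzWith L g) (hf : AbsolutelyContinuousOnInterval f a b) :
    AbsolutelyContinuousOnInterval (fun t => g (f t)) a b := by
  unfold AbsolutelyContinuousOnInterval at hf ⊢
  refine squeeze_zero (fun t => Finset.sum_nonneg fun i _ => dist_nonneg) (fun t => ?_)
    (by simpa using hf.const_mul (L : ℝ))
  rw [Finset.mul_sum]
  exact Finset.sum_le_sum fun i _ => hg.dist_le_mul _ _

theorem congr {X : Type*} [PseudoMetricSpace X] {f g : ℝ → X} {a b : ℝ}
    (hf : AbsolutelyContinuousOnInterval f a b) (h : ∀ t ∈ uIcc a b, f t = g t) :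
    AbsolutelyContinuousOnInterval g a b := by
  rw [absolutelyContinuousOnInterval_iff] at hf ⊢
  intro ε hε
  obtain ⟨δ, hδ, h'⟩ := hf ε hε
  refine ⟨δ, hδ, fun E hE hlen => ?_⟩
  convert h' E hE hlen using 1
  refine Finset.sum_congr rfl fun i hi => ?_
  rw [h _ (hE.1 i hi).1, h _ (hE.1 i hi).2]

/-- Absolute continuity on two adjacent intervals gives absolute continuity on their union. -/
theorem trans {X : Type*} [SeminormedAddCommGroup X] {f : ℝ → X} {a m b : ℝ} (ham : a ≤ m)
    (hmb : m ≤ b) (h₁ : AbsolutelyContinuousOnInterval f a m)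
    (h₂ : AbsolutelyContinuousOnInterval f m b) : AbsolutelyContinuousOnInterval f a b := by
  -- Gluing rests on the identity `f t = f (min t m) + f (max t m) - f m`.
  have k₁ : AbsolutelyContinuousOnInterval (fun t => f (min t m)) a b := by
    refine h₁.comp_monotone (fun x y h => by grind) (fun s t => ?_) (fun t ht => ?_)
    · simp only [Real.dist_eq]; grind
    · rw [uIcc_of_le (ham.trans hmb)] at ht
      rw [uIcc_of_le ham]
      exact ⟨le_min ht.1 ham, min_le_right _ _⟩
  have k₂ : AbsolutelyContinuousOnInterval (fun t => f (max t m)) a b := by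
    refine h₂.comp_monotone (fun x y h => by grind) (fun s t => ?_) (fun t ht => ?_)
    · simp only [Real.dist_eq]; grind
    · rw [uIcc_of_le (ham.trans hmb)] at ht
      rw [uIcc_of_le hmb]
      exact ⟨le_max_right _ _, max_le ht.2 hmb⟩
  have k₃ : AbsolutelyContinuousOnInterval (fun _ : ℝ => f m) a b :=
    ((LipschitzWith.const (f m)).lipschitzOnWith (s := uIcc a b)).absolutelyContinuousOnInterval
  refine ((k₁.add k₂).sub k₃).congr fun t _ => ?_
  rcases le_total t m with h | h <;> simp [h]

/-- An absolutely continuous curve with speed at most `M` almost everywhere moves by at most `M`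
times the elapsed time. -/
theorem norm_sub_le {X : Type*} [NormedAddCommGroup X] [InnerProductSpace ℝ X] {f : ℝ → X}
    {a b M : ℝ} (hM₀ : 0 ≤ M) (hab : a ≤ b) (hf : AbsolutelyContinuousOnInterval f a b)
    (hM : ∀ᵐ t : ℝ, t ∈ Ioo a b → ∃ v, ‖v‖ ≤ M ∧ HasDerivAt f v t) :
    ‖f b - f a‖ ≤ M * (b - a) := by
  -- Pairing with the total displacement reduces to the scalar fundamental theorem of calculus: `‖e‖
  -- ^ 2 ≤ ‖e‖ * M * (b - a)`.
  set e := f b - f a with he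
  have hg : AbsolutelyContinuousOnInterval (fun t => inner ℝ e (f t)) a b :=
    hf.comp_lipschitzWith (innerSL ℝ e).lipschitz
  have hint := hg.integral_deriv_eq_sub
  have hle : ∫ t in a..b, deriv (fun t => inner ℝ e (f t)) t ≤ ∫ t in a..b, ‖e‖ * M := by
    refine intervalIntegral.integral_mono_ae_restrict hab hg.intervalIntegrable_deriv
      intervalIntegrable_const ?_
    rw [EventuallyLE, ae_restrict_iff' measurableSet_Icc]
    filter_upwards [hM, compl_mem_ae_iff.2 (measure_singleton a),
      compl_mem_ae_iff.2 (measure_singleton b)] with t ht hta htb htI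
    obtain ⟨v, hv, hd⟩ := ht ⟨lt_of_le_of_ne htI.1 (Ne.symm hta), lt_of_le_of_ne htI.2 htb⟩
    have : HasDerivAt (fun t => inner ℝ e (f t)) (inner ℝ e v) t :=
      (innerSL ℝ e).hasFDerivAt.comp_hasDerivAt t hd
    rw [this.deriv]
    exact (real_inner_le_norm _ _).trans (mul_le_mul_of_nonneg_left hv (norm_nonneg _))
  rw [hint, ← inner_sub_right, ← he, real_inner_self_eq_norm_sq,
    intervalIntegral.integral_const, smul_eq_mul] at hle
  rcases (norm_nonneg e).eq_or_lt with h0 | h0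
  · rw [← h0]
    exact mul_nonneg hM₀ (by linarith)
  · nlinarith

end AbsolutelyContinuousOnInterval

/-! ### Flows: concatenation and limits at the right end. -/

namespace HybridSystem

variable {n : ℕ}

/-- The curve `w` flows according to `ẋ ∈ F x`, `x ∈ C` on the set of times `I`. -/
structure IsFlowOn (H : HybridSystem n) (I : Set ℝ) (w : ℝ → EuclideanSpace ℝ (Fin n)) :
    Prop where
  absolutelyContinuous : ∀ a b : ℝ, a ∈ I → b ∈ I → AbsolutelyContinuousOnInterval w a b
  mem : ∀ t ∈ interior I, w t ∈ H.C
  deriv : ∀ᵐ t : ℝ, t ∈ I → ∃ v ∈ H.F (w t), HasDerivAt w v t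

variable {H : HybridSystem n} {I : Set ℝ} {w : ℝ → EuclideanSpace ℝ (Fin n)} {T : ℝ}

theorem IsFlowOn.mono {I' : Set ℝ} (h : H.IsFlowOn I w) (hI : I' ⊆ I) : H.IsFlowOn I' w where
  absolutelyContinuous a b ha hb := h.absolutelyContinuous a b (hI ha) (hI hb)
  mem t ht := h.mem t (interior_mono hI ht)
  deriv := by filter_upwards [h.deriv] with t ht hm using ht (hI hm)

/-- Concatenation of a flow up to time `T` with a flow from the point reached at time `T`. -/
theorem IsFlowOn.concat (h : H.IsFlowOn I w) (hT : IsGreatest I T) (hI : I.OrdConnected)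
    {z : ℝ → EuclideanSpace ℝ (Fin n)}
    {ε : ℝ} (hz : H.IsFlowOn (Icc 0 ε) z) (hε : 0 < ε) (h0 : z 0 = w T) (hC : w T ∈ H.C) :
    H.IsFlowOn (I ∪ Icc T (T + ε)) (fun t => if t ≤ T then w t else z (t - T)) := by
  have hcong₁ : ∀ t, T < t → (fun t => if t ≤ T then w t else z (t - T)) =ᶠ[𝓝 t]
      fun t => z (t - T) := fun t ht => by
    filter_upwards [lt_mem_nhds ht] with s hs using if_neg (not_le.2 hs)
  have hcong₂ : ∀ t, t < T → (fun t => if t ≤ T then w t else z (t - T)) =ᶠ[𝓝 t] w := by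
    intro t ht
    filter_upwards [gt_mem_nhds ht] with s hs using if_pos hs.le
  refine ⟨?_, ?_, ?_⟩
  · have hw : ∀ a b, a ∈ I → b ∈ I →
        AbsolutelyContinuousOnInterval (fun t => if t ≤ T then w t else z (t - T)) a b := by
      intro a b ha hb
      refine (h.absolutelyContinuous a b ha hb).congr fun t ht => ?_
      rw [if_pos (hT.2 (hI.uIcc_subset ha hb ht))]
    have hzz : ∀ a b, a ∈ Icc T (T + ε) → b ∈ Icc T (T + ε) →
        AbsolutelyContinuousOnInterval (fun t => if t ≤ T then w t else z (t - T)) a b := by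
      intro a b ha hb
      have : AbsolutelyContinuousOnInterval (fun t => z (t - T)) a b := by
        refine (hz.absolutelyContinuous (a - T) (b - T) (by grind) (by grind)).comp_monotone
          (fun x y h => by grind) (fun s t => by simp) (fun t ht => ?_)
        grind [mem_uIcc]
      refine this.congr fun t ht => ?_
      have htT : T ≤ t := by grind [mem_uIcc]
      rcases htT.eq_or_lt with rfl | h'
      · simp [h0]
      · rw [if_neg (not_le.2 h')]
    have hTε : T ∈ Icc T (T + ε) := ⟨le_rfl, by linarith⟩
    rintro a b (ha | ha) (hb | hb)
    · exact hw a b ha hb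
    · exact (hw a T ha hT.1).trans (hT.2 ha) hb.1 (hzz T b hTε hb)
    · exact ((hw b T hb hT.1).trans (hT.2 hb) ha.1 (hzz T a hTε ha)).symm
    · exact hzz a b ha hb
  · intro t ht
    rcases lt_trichotomy t T with h' | rfl | h'
    · rw [if_pos h'.le]
      refine h.mem t (mem_interior_iff_mem_nhds.2 ?_)
      filter_upwards [mem_interior_iff_mem_nhds.1 ht, gt_mem_nhds h'] with s hs hsT
      exact hs.resolve_right fun hs => absurd hs.1 (not_le.2 hsT)
    -- The junction may become an interior time, although it is an endpoint of both pieces; neither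
    -- piece guarantees membership in `C` there.
    · simpa using hC
    · rw [if_neg (not_le.2 h')]
      refine hz.mem _ ?_
      rw [interior_Icc]
      refine ⟨by linarith, ?_⟩
      have : t ∈ interior (Iic (T + ε)) :=
        interior_mono (union_subset (fun s hs => (hT.2 hs).trans (by linarith)) fun s hs => hs.2) ht
      rw [interior_Iic] at this
      linarith [mem_Iio.1 this]
  · have hz' : ∀ᵐ t : ℝ, t - T ∈ Icc 0 ε → ∃ v ∈ H.F (z (t - T)), HasDerivAt z v (t - T) :=
      (measurePreserving_sub_right volume T).quasiMeasurePreserving.ae hz.deriv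
    filter_upwards [h.deriv, hz', compl_mem_ae_iff.2 (measure_singleton T)] with t h₁ h₂ htT ht
    rcases lt_or_gt_of_ne (show t ≠ T from htT) with h' | h'
    · obtain ⟨v, hv, hd⟩ := h₁ (ht.resolve_right fun hs => absurd hs.1 (not_le.2 h'))
      exact ⟨v, by rwa [if_pos h'.le], hd.congr_of_eventuallyEq (hcong₂ t h')⟩
    · have htε : t - T ∈ Icc 0 ε := by
        rcases ht with ht | ht
        · exact absurd (hT.2 ht) (not_le.2 h')
        · grind
      obtain ⟨v, hv, hd⟩ := h₂ htε
      refine ⟨v, by rwa [if_neg (not_le.2 h')], HasDerivAt.congr_of_eventuallyEq ?_ (hcong₁ t h')⟩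
      exact hd.comp_sub_const t T

/-- A flow up to time `T` that accumulates, as `t → T⁻`, at a point near which `F` is locally
bounded relative to `C` converges to that point, and the limit extends the flow to time `T`. -/
theorem IsFlowOn.update_of_mapClusterPt (h : H.IsFlowOn I w) (hI : I.OrdConnected)
    (hT : IsLUB I T) (hTI : T ∉ I) (hne : I.Nonempty) {p : EuclideanSpace ℝ (Fin n)}
    (hp : MapClusterPt p (𝓝[<] T) w) (hF : LocallyBoundedWithinAt H.F H.C p) :
    H.IsFlowOn (insert T I) (Function.update w T p) := by
  obtain ⟨s₀, hs₀⟩ := hne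
  have hlt : ∀ t ∈ I, t < T := fun t ht => lt_of_le_of_ne (hT.1 ht) fun e => hTI (e ▸ ht)
  have hIco : ∀ s ∈ I, Ico s T ⊆ I := fun s hs t ht => by
    obtain ⟨u, hu, hut⟩ := (lt_isLUB_iff hT).1 ht.2
    exact hI.out hs hu ⟨ht.1, hut.le⟩
  have hIoo : ∀ t ∈ Ioo s₀ T, t ∈ interior I := fun t ht =>
    mem_interior_iff_mem_nhds.2 (mem_of_superset (isOpen_Ioo.mem_nhds ht)
      (Ioo_subset_Ico_self.trans (hIco s₀ hs₀)))
  obtain ⟨U, hU, M, hM, hb⟩ := hF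
  obtain ⟨r, hr, hrU⟩ := Metric.mem_nhds_iff.1 hU
  have hclose : ∀ s < T, ∀ η > 0, ∃ t ∈ Ioo s T, dist (w t) p < η := fun s hs η hη => by
    have := (mapClusterPt_iff_frequently.1 hp _ (Metric.ball_mem_nhds p hη)).and_eventually
      (Ioo_mem_nhdsLT hs)
    obtain ⟨t, ht, ht'⟩ := this.exists
    exact ⟨t, ht', ht⟩
  -- Half of the radius absorbs the distance from `w s₁` to `p`, the other half the distance that
  -- can be covered at speed `M` before `T`.
  obtain ⟨s₁, hs₁, hs₁p⟩ := hclose (max s₀ (T - r / 2 / M))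
    (max_lt (hlt s₀ hs₀) (by linarith [show 0 < r / 2 / M by positivity])) (r / 2) (half_pos hr)
  have hs₀₁ : s₀ < s₁ := (le_max_left _ _).trans_lt hs₁.1
  have hs₁M : M * (T - s₁) < r / 2 := by
    have := (le_max_right s₀ (T - r / 2 / M)).trans_lt hs₁.1
    rw [← lt_div_iff₀' hM]; linarith
  have hsI : ∀ t ∈ Ico s₁ T, t ∈ I := fun t ht => hIco s₀ hs₀ ⟨hs₀₁.le.trans ht.1, ht.2⟩
  have hbound : ∀ a b, s₁ ≤ a → a ≤ b → b < T → (∀ t ∈ Ioo a b, w t ∈ Metric.ball p r) →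
      ‖w b - w a‖ ≤ M * (b - a) := fun a b hsa hab hbT hball => by
    refine (h.absolutelyContinuous a b (hsI a ⟨hsa, hab.trans_lt hbT⟩)
      (hsI b ⟨hsa.trans hab, hbT⟩)).norm_sub_le hM.le hab ?_
    filter_upwards [h.deriv] with t ht htab
    have htI : t ∈ Ioo s₀ T := ⟨hs₀₁.trans_le (hsa.trans htab.1.le), htab.2.trans hbT⟩
    obtain ⟨v, hv, hd⟩ := ht (hIco s₀ hs₀ ⟨htI.1.le, htI.2⟩)
    exact ⟨v, hb _ ⟨hrU (hball t htab), h.mem t (hIoo t htI)⟩ v hv, hd⟩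
  have hball : ∀ t ∈ Ico s₁ T, w t ∈ Metric.ball p r := by
    intro t ht
    by_contra hcon
    have hcont : ContinuousOn w (Icc s₁ t) := by
      rw [← uIcc_of_le ht.1]
      exact (h.absolutelyContinuous s₁ t (hsI _ ⟨le_rfl, hs₁.2⟩) (hsI t ht)).continuousOn
    have hcpt : IsCompact (Icc s₁ t ∩ w ⁻¹' (Metric.ball p r)ᶜ) :=
      isCompact_Icc.of_isClosed_subset
        (hcont.preimage_isClosed_of_isClosed isClosed_Icc Metric.isOpen_ball.isClosed_compl)
        inter_subset_left
    -- At the first exit time `τ` the speed bound still applies to all earlier times, which keeps `w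
    -- τ` inside the ball.
    obtain ⟨τ, ⟨hτ, hτb⟩, hτmin⟩ := hcpt.exists_isLeast ⟨t, ⟨ht.1, le_rfl⟩, hcon⟩
    have h1 := hbound s₁ τ le_rfl hτ.1 (hτ.2.trans_lt ht.2) fun u hu => by
      by_contra hu'
      exact absurd (hτmin ⟨⟨hu.1.le, hu.2.le.trans hτ.2⟩, hu'⟩) (not_le.2 hu.2)
    refine hτb (Metric.mem_ball.2 ?_)
    rw [← dist_eq_norm] at h1
    have h2 : M * (τ - s₁) ≤ M * (T - s₁) :=
      mul_le_mul_of_nonneg_left (by linarith [hτ.2, ht.2]) hM.le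
    linarith [dist_triangle (w τ) (w s₁) p]
  have hlip : ∀ a b, s₁ ≤ a → a ≤ b → b < T → dist (w a) (w b) ≤ M * (b - a) :=
    fun a b hsa hab hbT => by
      rw [dist_comm, dist_eq_norm]
      exact hbound a b hsa hab hbT fun t ht => hball t ⟨hsa.trans ht.1.le, ht.2.trans hbT⟩
  -- The Lipschitz bound passes to `p` along times at which `w` is close to `p`.
  have hlip_T : ∀ a, s₁ ≤ a → a < T → dist (w a) p ≤ M * (T - a) := fun a hsa haT => by
    refine le_of_forall_pos_le_add fun η hη => ?_
    obtain ⟨t, ht, htp⟩ := hclose a haT η hη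
    have h1 := hlip a t hsa ht.1.le ht.2
    have h2 : M * (t - a) ≤ M * (T - a) :=
      mul_le_mul_of_nonneg_left (by linarith [ht.2]) hM.le
    linarith [dist_triangle (w a) (w t) p]
  have hwT : ∀ t, t < T → Function.update w T p t = w t := fun t ht =>
    Function.update_of_ne ht.ne _ _
  have hlipU : ∀ a b, s₁ ≤ a → a ≤ b → b ≤ T →
      dist (Function.update w T p a) (Function.update w T p b) ≤ M * (b - a) := by
    intro a b hsa hab hbT
    rcases hbT.eq_or_lt with rfl | hbT
    · rcases hab.eq_or_lt with rfl | hab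
      · simp
      · rw [hwT a hab, Function.update_self]
        exact hlip_T a hsa hab
    · rw [hwT b hbT, hwT a (hab.trans_lt hbT)]
      exact hlip a b hsa hab hbT
  have hACT : ∀ a, s₁ ≤ a → a ≤ T →
      AbsolutelyContinuousOnInterval (Function.update w T p) a T := fun a hsa haT => by
    have : LipschitzOnWith M.toNNReal (Function.update w T p) (uIcc a T) := by
      rw [uIcc_of_le haT]
      refine LipschitzOnWith.of_dist_le_mul fun u hu v hv => ?_
      rw [Real.coe_toNNReal _ hM.le]
      rcases le_total u v with huv | huv
      · rw [Real.dist_eq, abs_sub_comm, abs_of_nonneg (by linarith)]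
        exact hlipU u v (hsa.trans hu.1) huv hv.2
      · rw [Real.dist_eq, abs_of_nonneg (by linarith), dist_comm]
        exact hlipU v u (hsa.trans hv.1) huv hu.2
    exact this.absolutelyContinuousOnInterval
  have hAC : ∀ a b, a ∈ I → b ∈ I →
      AbsolutelyContinuousOnInterval (Function.update w T p) a b := fun a b ha hb =>
    (h.absolutelyContinuous a b ha hb).congr fun t ht => (hwT t (hlt t (hI.uIcc_subset ha hb ht))).symm
  have hACIT : ∀ a ∈ I, AbsolutelyContinuousOnInterval (Function.update w T p) a T := by
    intro a ha
    rcases le_total s₁ a with hsa | hsa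
    · exact hACT a hsa (hlt a ha).le
    · exact (hAC a s₁ ha (hsI _ ⟨le_rfl, hs₁.2⟩)).trans hsa hs₁.2.le (hACT s₁ le_rfl hs₁.2.le)
  have hTmax : ∀ t ∈ insert T I, t ≤ T := by
    rintro t (rfl | ht)
    · exact le_rfl
    · exact (hlt t ht).le
  refine ⟨?_, ?_, ?_⟩
  · rintro a b (rfl | ha) (rfl | hb)
    · exact hACT _ hs₁.2.le le_rfl
    · exact (hACIT b hb).symm
    · exact hACIT a ha
    · exact hAC a b ha hb
  · intro t ht
    have htT : t < T := by
      have : t ∈ interior (Iic T) := interior_mono (fun s hs => hTmax s hs) ht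
      rwa [interior_Iic] at this
    rw [hwT t htT]
    refine h.mem t (mem_interior_iff_mem_nhds.2 ?_)
    filter_upwards [mem_interior_iff_mem_nhds.1 ht, gt_mem_nhds htT] with s hs hsT
    exact hs.resolve_left hsT.ne
  · filter_upwards [h.deriv, compl_mem_ae_iff.2 (measure_singleton T)] with t h₁ htT ht
    have htI : t ∈ I := ht.resolve_left htT
    obtain ⟨v, hv, hd⟩ := h₁ htI
    refine ⟨v, by rwa [hwT t (hlt t htI)], hd.congr_of_eventuallyEq ?_⟩
    filter_upwards [gt_mem_nhds (hlt t htI)] with s hs using hwT s hs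

end HybridSystem

/-! ### Hybrid time domains and their one-step extensions. -/

namespace IsHybridTimeDomain

variable {E : Set (ℝ × ℕ)}

/-- The switching times of a hybrid time domain up to a given hybrid time. -/
theorem exists_switching (hE : IsHybridTimeDomain E) {s : ℝ} {J : ℕ} (hs : (s, J) ∈ E) :
    ∃ t : ℕ → ℝ, t 0 = 0 ∧ t (J + 1) = s ∧ (∀ j ≤ J, t j ≤ t (j + 1)) ∧
      ∀ u j, ((u, j) ∈ E ∧ u ≤ s ∧ j ≤ J) ↔ (j ≤ J ∧ t j ≤ u ∧ u ≤ t (j + 1)) := by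
  obtain ⟨t, h0, hmono, heq⟩ := hE.truncation _ hs
  have key : ∀ u j, ((u, j) ∈ E ∧ u ≤ s ∧ j ≤ J) ↔ (j ≤ J ∧ t j ≤ u ∧ u ≤ t (j + 1)) := by
    intro u j
    have := Set.ext_iff.1 heq (u, j)
    simp only [mem_inter_iff, mem_prod, mem_Icc, mem_Iic, mem_ofPred_eq] at this
    rw [← this]
    exact ⟨fun h => ⟨h.1, ⟨hE.nonneg _ h.1, h.2.1⟩, h.2.2⟩, fun h => ⟨h.1, h.2.1.2, h.2.2⟩⟩
  refine ⟨t, h0, le_antisymm ?_ ?_, hmono, key⟩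
  · exact ((key (t (J + 1)) J).2 ⟨le_rfl, hmono J le_rfl, le_rfl⟩).2.1
  · exact ((key s J).1 ⟨hs, le_rfl, le_rfl⟩).2.2

theorem ordConnected (hE : IsHybridTimeDomain E) (J : ℕ) : {t | (t, J) ∈ E}.OrdConnected := by
  refine ⟨fun a ha b hb u hu => ?_⟩
  obtain ⟨t, -, h1, -, key⟩ := hE.exists_switching hb
  have := (key a J).1 ⟨ha, hu.1.trans hu.2, le_rfl⟩
  exact ((key u J).2 ⟨le_rfl, this.2.1.trans hu.1, hu.2.trans h1.ge⟩).1

/-- Earlier levels come before later ones. -/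
theorem le_of_lt (hE : IsHybridTimeDomain E) {s u : ℝ} {j J : ℕ} (hs : (s, J) ∈ E)
    (hu : (u, j) ∈ E) (hj : j < J) : u ≤ s := by
  rcases hE.chain _ hu _ hs with h | h
  · exact h.1
  · exact absurd h.2 (not_le.2 hj)

/-- Prolonging the last interval of a hybrid time domain. -/
theorem union_prod (hE : IsHybridTimeDomain E) {J : ℕ} (hJ : ∀ p ∈ E, p.2 ≤ J) {s : ℝ}
    (hs : (s, J) ∈ E) {I : Set ℝ} (hI : I.OrdConnected) (hsub : ∀ t, (t, J) ∈ E → t ∈ I)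
    (hI_ge : ∀ t ∈ I, (t, J) ∉ E → ∀ u, (u, J) ∈ E → u ≤ t) :
    IsHybridTimeDomain (E ∪ I ×ˢ {J}) := by
  have hcmp : ∀ p ∈ E, ∀ t ∈ I, (t, J) ∉ E → p.1 ≤ t := by
    rintro ⟨u, j⟩ hp t ht htE
    have hsle := hI_ge t ht htE s hs
    rcases (hJ _ hp).eq_or_lt with h | h
    · obtain rfl : j = J := h
      exact hI_ge t ht htE u hp
    · exact (hE.le_of_lt hs hp h).trans hsle
  have hmem : ∀ u j, (u, j) ∈ E ∪ I ×ˢ {J} ↔ (u, j) ∈ E ∨ (u ∈ I ∧ j = J) := by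
    intro u j; simp
  have hcases : ∀ p ∈ E ∪ I ×ˢ {J}, p ∈ E ∨ ∃ t ∈ I, (t, J) ∉ E ∧ p = (t, J) := by
    rintro ⟨u, j⟩ hp
    by_cases h : (u, j) ∈ E
    · exact Or.inl h
    · obtain ⟨hu, rfl⟩ := ((hmem u j).1 hp).resolve_left h
      exact Or.inr ⟨u, hu, h, rfl⟩
  refine ⟨?_, ?_, ?_⟩
  · intro p hp
    rcases hcases p hp with h | ⟨t, ht, htE, rfl⟩
    · exact hE.nonneg p h
    · exact (hE.nonneg _ hs).trans (hI_ge t ht htE s hs)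
  · intro p hp
    rcases hcases p hp with h | ⟨r, hr, hrE, rfl⟩
    · obtain ⟨t, h0, hmono, heq⟩ := hE.truncation p h
      refine ⟨t, h0, hmono, ?_⟩
      rw [← heq]
      refine Subset.antisymm ?_ (inter_subset_inter_left _ subset_union_left)
      rintro q ⟨hq, hbox⟩
      refine ⟨?_, hbox⟩
      rcases hcases q hq with h' | ⟨u, hu, huE, rfl⟩
      · exact h'
      · obtain ⟨p₁, p₂⟩ := p
        obtain rfl : p₂ = J := le_antisymm (hJ _ h) hbox.2
        rwa [le_antisymm (show u ≤ p₁ from hbox.1.2) (hcmp _ h u hu huE)]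
    · obtain ⟨t, h0, h1, hmono, key⟩ := hE.exists_switching hs
      have hsr := hI_ge r hr hrE s hs
      have htJ := ((key (t J) J).2 ⟨le_rfl, le_rfl, hmono J le_rfl⟩).1
      -- Only the final switching time moves, from `s` to `r`.
      refine ⟨fun i => if i ≤ J then t i else r, by simpa using h0, fun j hj => ?_, ?_⟩
      · have := hmono j hj
        rcases hj.eq_or_lt with rfl | hj'
        · simp; linarith
        · simp only [hj, if_true, Nat.succ_le_of_lt hj', this]
      · ext ⟨u, j⟩
        simp only [mem_inter_iff, hmem, mem_prod, mem_Icc, mem_Iic, mem_ofPred_eq]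
        constructor
        · rintro ⟨hu, ⟨hu0, hur⟩, hj⟩
          refine ⟨hj, ?_⟩
          rcases hj.eq_or_lt with rfl | hj'
          · simp only [le_refl, if_true, Nat.not_succ_le_self, if_false, hur, and_true]
            by_cases huE : (u, j) ∈ E
            · rcases le_total u s with hus | hus
              · exact ((key u j).1 ⟨huE, hus, le_rfl⟩).2.1
              · linarith [hmono j le_rfl]
            · exact hI_ge u (hu.resolve_left huE).1 huE _ htJ
          · have huE : (u, j) ∈ E := hu.resolve_right fun h => hj'.ne h.2
            simpa only [hj, if_true, Nat.succ_le_of_lt hj'] using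
              ((key u j).1 ⟨huE, hE.le_of_lt hs huE hj', hj⟩).2
        · rintro ⟨hj, hu⟩
          rcases hj.eq_or_lt with rfl | hj'
          · simp only [le_refl, if_true, Nat.not_succ_le_self, if_false] at hu
            exact ⟨Or.inr ⟨hI.out (hsub _ htJ) hr hu, rfl⟩,
              ⟨(hE.nonneg _ htJ).trans hu.1, hu.2⟩, le_rfl⟩
          · simp only [hj, if_true, Nat.succ_le_of_lt hj'] at hu
            have := (key u j).2 ⟨hj, hu⟩
            exact ⟨Or.inl this.1, ⟨hE.nonneg _ this.1, this.2.1.trans hsr⟩, hj⟩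
  · intro p hp q hq
    rcases hcases p hp with h | ⟨r, hr, hrE, rfl⟩ <;> rcases hcases q hq with h' | ⟨u, hu, huE, rfl⟩
    · exact hE.chain p h q h'
    · exact Or.inl ⟨hcmp p h u hu huE, hJ p h⟩
    · exact Or.inr ⟨hcmp q h' r hr hrE, hJ q h'⟩
    · rcases le_total r u with h | h
      · exact Or.inl ⟨h, le_rfl⟩
      · exact Or.inr ⟨h, le_rfl⟩

/-- Appending a jump at the last hybrid time. -/
theorem insert_jump (hE : IsHybridTimeDomain E) {T : ℝ} {J : ℕ} (hT : (T, J) ∈ E)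
    (hmax : ∀ p ∈ E, p ≤ (T, J)) : IsHybridTimeDomain (insert (T, J + 1) E) := by
  have hle : (T, J) ≤ (T, J + 1) := ⟨le_rfl, Nat.le_succ J⟩
  refine ⟨?_, ?_, ?_⟩
  · rintro p (rfl | hp)
    · exact hE.nonneg (T, J) hT
    · exact hE.nonneg p hp
  · rintro p (rfl | hp)
    · obtain ⟨t, h0, h1, hmono, key⟩ := hE.exists_switching hT
      -- The new level `J + 1` occupies the degenerate interval `[T, T]`.
      refine ⟨fun i => if i ≤ J + 1 then t i else T, by simpa using h0, fun j hj => ?_, ?_⟩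
      · dsimp only at hj
        rcases hj.eq_or_lt with rfl | hj'
        · simp [h1]
        · have hj'' : j ≤ J := by omega
          simpa [hj, hj''] using hmono j hj''
      · ext ⟨u, j⟩
        simp only [mem_inter_iff, mem_insert_iff, Prod.mk.injEq, mem_prod, mem_Icc, mem_Iic,
          mem_ofPred_eq]
        constructor
        · rintro ⟨⟨rfl, rfl⟩ | hu, ⟨hu0, hur⟩, hj⟩
          · simp [h1]
          · have hj' : j ≤ J := (hmax _ hu).2
            simpa [hj, hj'] using ((key u j).1 ⟨hu, hur, hj'⟩).2
        · rintro ⟨hj, hu⟩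
          rcases hj.eq_or_lt with rfl | hj'
          · simp only [le_refl, if_true, h1, Nat.not_succ_le_self, if_false] at hu
            obtain rfl : u = T := le_antisymm hu.2 hu.1
            exact ⟨Or.inl ⟨rfl, rfl⟩, ⟨hE.nonneg _ hT, le_rfl⟩, le_rfl⟩
          · have hj'' : j ≤ J := by omega
            simp only [hj, if_true, add_le_add_iff_right, hj''] at hu
            have := (key u j).2 ⟨hj'', hu⟩
            exact ⟨Or.inr this.1, ⟨hE.nonneg _ this.1, this.2.1⟩, hj⟩
    · obtain ⟨t, h0, hmono, heq⟩ := hE.truncation p hp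
      refine ⟨t, h0, hmono, ?_⟩
      rw [← heq]
      refine Subset.antisymm ?_ (inter_subset_inter_left _ (subset_insert _ _))
      rintro q ⟨rfl | hq, hbox⟩
      · exact absurd (hbox.2.trans (hmax p hp).2) (Nat.not_succ_le_self J)
      · exact ⟨hq, hbox⟩
  · rintro p (rfl | hp) q (rfl | hq)
    · exact Or.inl le_rfl
    · exact Or.inr ((hmax q hq).trans hle)
    · exact Or.inl ((hmax p hp).trans hle)
    · exact hE.chain p hp q hq

end IsHybridTimeDomain

/-! ### Extending solutions by a flow or by a jump. -/

namespace HybridSystem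

variable {n : ℕ} {H : HybridSystem n} {x : HybridArc n} {J : ℕ}

theorem IsSolution.ordConnected (hx : H.IsSolution x) (j : ℕ) : (x.flowInterval j).OrdConnected :=
  hx.isHybridTimeDomain.ordConnected j

/-- Between jumps, a solution flows. -/
theorem IsSolution.isFlowOn (hx : H.IsSolution x) (j : ℕ) :
    H.IsFlowOn (x.flowInterval j) (fun t => x.val t j) where
  absolutelyContinuous := hx.absolutelyContinuous j
  mem t ht := hx.flow_mem j ⟨t, ht⟩ t ht
  deriv := by
    by_cases h : (interior (x.flowInterval j)).Nonempty
    · exact hx.flow_deriv j h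
    -- The derivative clause for solutions is silent about intervals with empty interior; these are
    -- null sets, so nothing is needed there.
    · have hsub : (x.flowInterval j).Subsingleton := by
        intro a ha b hb
        by_contra hab
        wlog hlt : a < b generalizing a b
        · exact this hb ha (Ne.symm hab) (lt_of_le_of_ne (not_lt.1 hlt) (Ne.symm hab))
        refine h ((nonempty_Ioo.2 hlt).mono ?_)
        rw [← interior_Icc]
        exact interior_mono ((hx.ordConnected j).out ha hb)
      filter_upwards [compl_mem_ae_iff.2 (hsub.measure_zero volume)] with t ht ht'
      exact absurd ht' ht

/-- Prolonging the last flow of a solution. -/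
theorem IsSolution.exists_extend_flow (hx : H.IsSolution x) (hJ : ∀ p ∈ x.dom, p.2 ≤ J)
    (hne : (x.flowInterval J).Nonempty) {I : Set ℝ} (hI : I.OrdConnected)
    (hsub : x.flowInterval J ⊆ I)
    (hI_ge : ∀ t ∈ I, t ∉ x.flowInterval J → ∀ u ∈ x.flowInterval J, u ≤ t)
    {w : ℝ → EuclideanSpace ℝ (Fin n)} (hw : H.IsFlowOn I w)
    (hwx : ∀ t ∈ x.flowInterval J, w t = x.val t J) :
    ∃ y : HybridArc n, H.IsSolution y ∧ y.dom = x.dom ∪ I ×ˢ {J} ∧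
      ∀ p ∈ x.dom, x.val p.1 p.2 = y.val p.1 p.2 := by
  obtain ⟨s, hs⟩ := hne
  let y : HybridArc n :=
    { dom := x.dom ∪ I ×ˢ {J}, val := fun t j => if j = J then w t else x.val t j }
  have hagree : ∀ t j, (t, j) ∈ x.dom → x.val t j = y.val t j := by
    intro t j ht
    by_cases h : j = J
    · subst h; simpa [y] using (hwx t ht).symm
    · simp [y, h]
  have hyJ : y.flowInterval J = I := by
    ext t
    simp only [HybridArc.flowInterval, y, mem_ofPred_eq, mem_union, mem_prod,
      mem_singleton_iff, and_true]
    exact ⟨fun h => h.elim (fun h => hsub h) id, Or.inr⟩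
  have hyj : ∀ j, j ≠ J → y.flowInterval j = x.flowInterval j := by
    intro j hj
    ext t
    simp [HybridArc.flowInterval, y, hj]
  have hvJ : (fun t => y.val t J) = w := by funext t; simp [y]
  have hvj : ∀ j, j ≠ J → (fun t => y.val t j) = fun t => x.val t j := by
    intro j hj; funext t; simp [y, hj]
  have hflow : ∀ j, H.IsFlowOn (y.flowInterval j) (fun t => y.val t j) := by
    intro j
    by_cases h : j = J
    · subst h; rwa [hyJ, hvJ]
    · rw [hyj j h, hvj j h]; exact hx.isFlowOn j
  refine ⟨y, ⟨hx.isHybridTimeDomain.union_prod hJ hs hI (fun t ht => hsub ht) hI_ge,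
    Or.inl hx.zero_mem, fun j => (hflow j).absolutelyContinuous, ?_, fun j _ => (hflow j).mem,
    fun j _ => (hflow j).deriv, ?_⟩, rfl, fun p hp => hagree p.1 p.2 hp⟩
  · rw [← hagree 0 0 hx.zero_mem]; exact hx.init_mem
  · intro t j h₁ h₂
    have hj₂ : j + 1 ≤ J := by
      rcases h₂ with h | h
      · exact hJ _ h
      · exact (h.2 : j + 1 = J).le
    have h₁' : (t, j) ∈ x.dom := by
      rcases h₁ with h | h
      · exact h
      · exact absurd (show j = J from h.2) (Nat.ne_of_lt hj₂)
    -- Prolonging creates no new jump: a new time at level `J` that is also a time of the previous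
    -- level would be squeezed onto the old time `s`.
    have h₂' : (t, j + 1) ∈ x.dom := by
      by_contra hcon
      have h := h₂.resolve_left hcon
      obtain rfl : j + 1 = J := h.2
      have h3 := hI_ge t h.1 hcon s hs
      have h4 := hx.isHybridTimeDomain.le_of_lt hs h₁' (Nat.lt_succ_self j)
      exact hcon (le_antisymm h4 h3 ▸ hs)
    rw [← hagree _ _ h₁', ← hagree _ _ h₂']
    exact hx.jump t j h₁' h₂'

/-- The last flow of a maximal solution cannot be prolonged. -/
theorem IsMaximalSolution.subset_flowInterval (hx : H.IsMaximalSolution x)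
    (hJ : ∀ p ∈ x.dom, p.2 ≤ J) (hne : (x.flowInterval J).Nonempty) {I : Set ℝ}
    (hI : I.OrdConnected) (hsub : x.flowInterval J ⊆ I)
    (hI_ge : ∀ t ∈ I, t ∉ x.flowInterval J → ∀ u ∈ x.flowInterval J, u ≤ t)
    {w : ℝ → EuclideanSpace ℝ (Fin n)} (hw : H.IsFlowOn I w)
    (hwx : ∀ t ∈ x.flowInterval J, w t = x.val t J) : I ⊆ x.flowInterval J := by
  obtain ⟨y, hy, hdom, hval⟩ := hx.1.exists_extend_flow hJ hne hI hsub hI_ge hw hwx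
  intro t ht
  by_contra hcon
  refine hx.2 ⟨y, hy, ⟨hdom ▸ subset_union_left, fun h => hcon (h ?_)⟩, hval⟩
  rw [hdom]
  exact Or.inr ⟨ht, rfl⟩

/-- A maximal solution does not end at a point from which a jump is possible. -/
theorem IsMaximalSolution.notMem_of_isGreatest (hx : H.IsMaximalSolution x) {T : ℝ}
    (hT : (T, J) ∈ x.dom) (hmax : ∀ p ∈ x.dom, p ≤ (T, J))
    (hG : ∀ q ∈ H.D, (H.G q).Nonempty) : x.val T J ∉ H.D := by
  intro hD
  obtain ⟨g, hg⟩ := hG _ hD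
  have hnot : (T, J + 1) ∉ x.dom := fun h => Nat.not_succ_le_self J (hmax _ h).2
  let y : HybridArc n :=
    { dom := insert (T, J + 1) x.dom, val := fun t j => if j = J + 1 then g else x.val t j }
  have hagree : ∀ t j, (t, j) ∈ x.dom → x.val t j = y.val t j := by
    intro t j ht
    have : j ≠ J + 1 := by have : j ≤ J := (hmax _ ht).2; omega
    simp [y, this]
  have hflow : ∀ j, H.IsFlowOn (y.flowInterval j) (fun t => y.val t j) := by
    intro j
    by_cases h : j = J + 1
    · subst h
      have h1 : y.flowInterval (J + 1) = {T} := by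
        ext t
        simp only [HybridArc.flowInterval, y, mem_ofPred_eq, mem_insert_iff, Prod.mk.injEq,
          and_true, mem_singleton_iff]
        exact ⟨fun h => h.resolve_right fun h => Nat.not_succ_le_self J (hmax _ h).2, Or.inl⟩
      rw [h1]
      refine ⟨?_, by simp, ?_⟩
      · rintro a b rfl rfl
        exact LipschitzOnWith.absolutelyContinuousOnInterval (K := 0)
          (LipschitzOnWith.of_dist_le_mul fun u hu v hv => by simp [y])
      · filter_upwards [compl_mem_ae_iff.2 (measure_singleton T)] with t ht ht'
        exact absurd ht' ht
    · have h1 : y.flowInterval j = x.flowInterval j := by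
        ext t; simp [HybridArc.flowInterval, y, h]
      have h2 : (fun t => y.val t j) = fun t => x.val t j := by funext t; simp [y, h]
      rw [h1, h2]
      exact hx.1.isFlowOn j
  have hy : H.IsSolution y := by
    refine ⟨hx.1.isHybridTimeDomain.insert_jump hT hmax, Or.inr hx.1.zero_mem,
      fun j => (hflow j).absolutelyContinuous, ?_, fun j _ => (hflow j).mem,
      fun j _ => (hflow j).deriv, ?_⟩
    · rw [← hagree 0 0 hx.1.zero_mem]; exact hx.1.init_mem
    · rintro t j h₁ (h₂ | h₂)
      · obtain ⟨rfl, hj⟩ := Prod.mk.inj h₂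
        obtain rfl : j = J := by omega
        rw [← hagree _ _ hT]
        exact ⟨hD, by simpa [y] using hg⟩
      · have h₁' : (t, j) ∈ x.dom := by
          rcases h₁ with h₁ | h₁
          · have : j = J + 1 := (Prod.mk.inj h₁).2
            have : j + 1 ≤ J := (hmax _ h₂).2
            omega
          · exact h₁
        rw [← hagree _ _ h₁', ← hagree _ _ h₂]
        exact hx.1.jump t j h₁' h₂
  exact hx.2 ⟨y, hy, ⟨subset_insert _ _, fun h => hnot (h (mem_insert _ _))⟩,
    fun p hp => hagree p.1 p.2 hp⟩

end HybridSystem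

/-! ### Regularity of the flow map. -/

/-- An outer semicontinuous, locally bounded map is upper semicontinuous: near a point, its values
lie in any closed thickening of its value at that point. -/
theorem OuterSemicontinuousOn.exists_subset_cthickening {n : ℕ}
    {F : EuclideanSpace ℝ (Fin n) → Set (EuclideanSpace ℝ (Fin n))}
    {C : Set (EuclideanSpace ℝ (Fin n))} (hF : OuterSemicontinuousOn F C)
    {x : EuclideanSpace ℝ (Fin n)} (hx : x ∈ C) (hb : LocallyBoundedWithinAt F C x) {η : ℝ}
    (hη : 0 < η) : ∃ δ > 0, ∀ y ∈ C, dist y x < δ → F y ⊆ Metric.cthickening η (F x) := by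
  by_contra! hcon
  obtain ⟨U, hU, M, -, hM⟩ := hb
  have hlim := tendsto_one_div_add_atTop_nhds_zero_nat (𝕜 := ℝ)
  have hcon' : ∀ k : ℕ, ∃ y v, y ∈ C ∧ dist y x < 1 / ((k : ℝ) + 1) ∧ v ∈ F y ∧
      v ∉ Metric.cthickening η (F x) := fun k => by
    obtain ⟨y, hy, hd, hn⟩ := hcon (1 / ((k : ℝ) + 1)) (by positivity)
    obtain ⟨v, hv, hv'⟩ := not_subset.1 hn
    exact ⟨y, v, hy, hd, hv, hv'⟩
  choose y v hyC hyd hvF hvn using hcon'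
  have hy : Tendsto y atTop (𝓝 x) :=
    tendsto_iff_dist_tendsto_zero.2 (squeeze_zero (fun _ => dist_nonneg) (fun k => (hyd k).le) hlim)
  have hvb : ∃ᶠ k in atTop, v k ∈ Metric.closedBall (0 : EuclideanSpace ℝ (Fin n)) M := by
    refine Eventually.frequently ?_
    filter_upwards [hy hU] with k hk
    exact mem_closedBall_zero_iff.2 (hM _ ⟨hk, hyC k⟩ _ (hvF k))
  obtain ⟨a, -, φ, hφ, ha⟩ :=
    (isCompact_closedBall (0 : EuclideanSpace ℝ (Fin n)) M).isSeqCompact.subseq_of_frequently_in hvb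
  have haF : a ∈ F x := hF x hx (y ∘ φ) (v ∘ φ) a (fun i => hyC _) (fun i => hvF _)
    (hy.comp hφ.tendsto_atTop) ha
  obtain ⟨k, hk⟩ := (ha.eventually (Metric.closedBall_mem_nhds a hη)).exists
  exact hvn _ (Metric.mem_cthickening_of_dist_le _ a η _ haF hk)

/-- Take the base sequence constant. Closedness is what lets the closed thickenings of `F x` shrink
to `F x` itself. -/
theorem OuterSemicontinuousOn.isClosed {n : ℕ}
    {F : EuclideanSpace ℝ (Fin n) → Set (EuclideanSpace ℝ (Fin n))}
    {C : Set (EuclideanSpace ℝ (Fin n))} (hF : OuterSemicontinuousOn F C)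
    {x : EuclideanSpace ℝ (Fin n)} (hx : x ∈ C) : IsClosed (F x) :=
  IsSeqClosed.isClosed fun v a hv ha =>
    hF x hx (fun _ => x) v a (fun _ => hx) hv tendsto_const_nhds ha

/-! ### Euler schemes and their limits. -/

section EulerPolygon

variable {X : Type*} [NormedAddCommGroup X] [NormedSpace ℝ X]

/-- The points of the Euler scheme of step `h` for the field `f`. -/
def eulerPoint (f : X → X) (x₀ : X) (h : ℝ) : ℕ → X
  | 0 => x₀
  | i + 1 => eulerPoint f x₀ h i + h • f (eulerPoint f x₀ h i)

variable {f : X → X} {x₀ : X} {h M : ℝ}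

theorem eulerPoint_add_sub (a m : ℕ) : eulerPoint f x₀ h (a + m) - eulerPoint f x₀ h a =
    h • ∑ i ∈ Finset.range m, f (eulerPoint f x₀ h (a + i)) := by
  induction m with
  | zero => simp
  | succ m ih => rw [Finset.sum_range_succ, smul_add, ← ih, ← add_assoc, eulerPoint]; abel

theorem norm_eulerPoint_add_sub_le (hh : 0 ≤ h) (hf : ∀ y, ‖f y‖ ≤ M) (a m : ℕ) :
    ‖eulerPoint f x₀ h (a + m) - eulerPoint f x₀ h a‖ ≤ M * (h * m) := by
  rw [eulerPoint_add_sub, norm_smul, Real.norm_of_nonneg hh]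
  have : ‖∑ i ∈ Finset.range m, f (eulerPoint f x₀ h (a + i))‖ ≤ m * M :=
    (norm_sum_le _ _).trans ((Finset.sum_le_sum fun i _ => hf _).trans (by simp))
  nlinarith

/-- The mean slope of the Euler scheme lies in any convex set containing the field along it. -/
theorem smul_eulerPoint_add_sub_mem (hh : 0 < h) {A : Set X} (hA : Convex ℝ A) {a m : ℕ}
    (hm : 0 < m) (hmem : ∀ i < m, f (eulerPoint f x₀ h (a + i)) ∈ A) :
    (h * m)⁻¹ • (eulerPoint f x₀ h (a + m) - eulerPoint f x₀ h a) ∈ A := by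
  have hm' : (0 : ℝ) < m := Nat.cast_pos.2 hm
  rw [eulerPoint_add_sub, smul_smul, mul_inv, mul_right_comm, inv_mul_cancel₀ hh.ne', one_mul,
    Finset.smul_sum]
  refine hA.sum_mem (fun _ _ => by positivity) ?_ fun i hi => hmem i (Finset.mem_range.1 hi)
  simp [hm'.ne']

/-- The piecewise constant interpolation of the Euler scheme. -/
noncomputable def eulerCurve (f : X → X) (x₀ : X) (h t : ℝ) : X := eulerPoint f x₀ h ⌊t / h⌋₊

theorem mul_floor_bounds (hh : 0 < h) {t : ℝ} (ht : 0 ≤ t) :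
    h * ⌊t / h⌋₊ ≤ t ∧ t < h * ⌊t / h⌋₊ + h := by
  have h1 := Nat.floor_le (div_nonneg ht hh.le)
  have h2 := Nat.lt_floor_add_one (t / h)
  rw [le_div_iff₀' hh] at h1
  rw [div_lt_iff₀' hh] at h2
  exact ⟨h1, by linarith⟩

/-- The extra `h` pays for the piecewise constant interpolation: rounding `s` and `t` down to the
grid can lengthen the gap by up to one step. -/
theorem norm_eulerCurve_sub_le (hh : 0 < h) (hM : 0 ≤ M) (hf : ∀ y, ‖f y‖ ≤ M) {s t : ℝ}
    (hs : 0 ≤ s) (hst : s ≤ t) :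
    ‖eulerCurve f x₀ h t - eulerCurve f x₀ h s‖ ≤ M * (t - s + h) := by
  obtain ⟨m, hm⟩ := Nat.exists_eq_add_of_le (Nat.floor_le_floor (div_le_div_of_nonneg_right hst hh.le))
  have h1 := mul_floor_bounds hh hs
  have h2 := mul_floor_bounds hh (hs.trans hst)
  rw [eulerCurve, eulerCurve, hm]
  refine (norm_eulerPoint_add_sub_le hh.le hf _ _).trans (mul_le_mul_of_nonneg_left ?_ hM)
  rw [hm] at h2
  push_cast at h2
  linarith [h1.2, h2.1]

end EulerPolygon

/-- The limit of Euler polygons solves the differential inclusion wherever it is differentiable. -/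
theorem deriv_mem_of_tendsto_eulerCurve {X : Type*} [NormedAddCommGroup X] [NormedSpace ℝ X]
    {f : X → X} {x₀ : X} {M : ℝ} (hM : 0 ≤ M) (hf : ∀ y, ‖f y‖ ≤ M) {h : ℕ → ℝ}
    (hh : ∀ k, 0 < h k) {l : Filter ℕ} [l.NeBot] (hl : Tendsto h l (𝓝 0)) {w : ℝ → X}
    (hw : ∀ t, 0 ≤ t → Tendsto (fun k => eulerCurve f x₀ (h k) t) l (𝓝 (w t))) {t : ℝ}
    (ht : 0 ≤ t) {v : X} (hv : HasDerivAt w v t) {A : Set X} (hA : Convex ℝ A) (hAc : IsClosed A)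
    {δ : ℝ} (hδ : 0 < δ) (hfA : ∀ y, dist y (w t) < δ → f y ∈ A) : v ∈ A := by
  have hslope : Tendsto (slope w t) (𝓝[>] t) (𝓝 v) :=
    (hasDerivAt_iff_tendsto_slope.1 hv).mono_left (nhdsWithin_mono _ fun s hs => ne_of_gt hs)
  -- Three errors share `δ`: the motion over `[t, s]`, one extra Euler step, and the distance from
  -- the scheme to `w t`.
  have hnear : ∀ᶠ s in 𝓝[>] t, M * (s - t) < δ / 3 := by
    have : Tendsto (fun s => M * (s - t)) (𝓝 t) (𝓝 (M * (t - t))) :=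
      Continuous.tendsto (by fun_prop) t
    rw [sub_self, mul_zero] at this
    exact (this.mono_left nhdsWithin_le_nhds).eventually (gt_mem_nhds (by positivity))
  refine hAc.mem_of_tendsto hslope ?_
  filter_upwards [hnear, self_mem_nhdsWithin] with s hs hts
  have hts : t < s := hts
  have hs0 : 0 ≤ s := ht.trans hts.le
  rw [slope_def_module]
  have hfl : ∀ u, 0 ≤ u → Tendsto (fun k => h k * (⌊u / h k⌋₊ : ℝ)) l (𝓝 u) := fun u hu => by
    refine tendsto_of_tendsto_of_tendsto_of_le_of_le (g := fun k => u - h k) (h := fun _ => u)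
      (by simpa using hl.const_sub u) tendsto_const_nhds
      (fun k => by linarith [(mul_floor_bounds (hh k) hu).2])
      (fun k => (mul_floor_bounds (hh k) hu).1)
  -- Dividing by the gap between grid times, not by `s - t`, makes each quotient exactly an average
  -- of values of `f`.
  have hlim : Tendsto (fun k => (h k * (⌊s / h k⌋₊ : ℝ) - h k * (⌊t / h k⌋₊ : ℝ))⁻¹ •
      (eulerCurve f x₀ (h k) s - eulerCurve f x₀ (h k) t)) l (𝓝 ((s - t)⁻¹ • (w s - w t))) :=
    (((hfl s hs0).sub (hfl t ht)).inv₀ (sub_pos.2 hts).ne').smul ((hw s hs0).sub (hw t ht))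
  have hMh : Tendsto (fun k => M * h k) l (𝓝 0) := by simpa using hl.const_mul M
  refine hAc.mem_of_tendsto hlim ?_
  filter_upwards [hl.eventually (gt_mem_nhds (sub_pos.2 hts)),
    hMh.eventually (gt_mem_nhds (show 0 < δ / 3 by positivity)),
    Metric.tendsto_nhds.1 (hw t ht) (δ / 3) (by positivity)] with k hk₁ hk₂ hk₃
  obtain ⟨m, hm⟩ :=
    Nat.exists_eq_add_of_le (Nat.floor_le_floor (div_le_div_of_nonneg_right hts.le (hh k).le))
  have b₁ := mul_floor_bounds (hh k) ht
  have b₂ := mul_floor_bounds (hh k) hs0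
  rw [hm] at b₂
  push_cast at b₂
  -- A step shorter than `s - t` separates the two grid indices.
  have hmpos : 0 < m := by
    rcases Nat.eq_zero_or_pos m with rfl | hpos
    · simp only [Nat.cast_zero, add_zero] at b₂
      linarith [b₁.1, b₂.2]
    · exact hpos
  rw [hm, Nat.cast_add, mul_add, add_sub_cancel_left, eulerCurve, eulerCurve, hm]
  refine smul_eulerPoint_add_sub_mem (hh k) hA hmpos fun i hi => hfA _ ?_
  have h1 : dist (eulerPoint f x₀ (h k) (⌊t / h k⌋₊ + i)) (eulerPoint f x₀ (h k) ⌊t / h k⌋₊) ≤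
      M * (s - t + h k) := by
    rw [dist_eq_norm]
    refine (norm_eulerPoint_add_sub_le (hh k).le hf _ _).trans (mul_le_mul_of_nonneg_left ?_ hM)
    have : h k * (i : ℝ) ≤ h k * m :=
      mul_le_mul_of_nonneg_left (Nat.cast_le.2 hi.le) (hh k).le
    linarith [b₁.2, b₂.1]
  have h2 := dist_triangle (eulerPoint f x₀ (h k) (⌊t / h k⌋₊ + i))
    (eulerPoint f x₀ (h k) ⌊t / h k⌋₊) (w t)
  rw [eulerCurve] at hk₃
  linarith

/-! ### Local existence at interior points of the flow set. -/

namespace HybridSystem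

variable {n : ℕ} {H : HybridSystem n}

/-- Local existence for differential inclusions: flow is possible from interior points of `C`. -/
theorem exists_isFlowOn_of_mem_interior (hF_osc : OuterSemicontinuousOn H.F H.C)
    (hF_bdd : ∀ x ∈ H.C, LocallyBoundedWithinAt H.F H.C x)
    (hF_nonempty : ∀ x ∈ H.C, (H.F x).Nonempty) (hF_convex : ∀ x ∈ H.C, Convex ℝ (H.F x))
    {x₀ : EuclideanSpace ℝ (Fin n)} (hx₀ : x₀ ∈ interior H.C) :
    ∃ ε > 0, ∃ w, H.IsFlowOn (Icc 0 ε) w ∧ w 0 = x₀ := by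
  classical
  obtain ⟨U, hU, M, hM, hb⟩ := hF_bdd x₀ (interior_subset hx₀)
  obtain ⟨r, hr, hrU⟩ := Metric.mem_nhds_iff.1
    (inter_mem hU (mem_interior_iff_mem_nhds.1 hx₀))
  choose! g hg using hF_nonempty
  -- An arbitrary selection, with no continuity; the value `0` off the ball makes the bound `M`
  -- global.
  set f : EuclideanSpace ℝ (Fin n) → EuclideanSpace ℝ (Fin n) :=
    fun y => if y ∈ Metric.ball x₀ r then g y else 0 with hf_def
  have hfF : ∀ y ∈ Metric.ball x₀ r, f y ∈ H.F y := fun y hy => by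
    rw [hf_def]; simp only [hy, if_true]
    exact hg y (hrU hy).2
  have hfM : ∀ y, ‖f y‖ ≤ M := fun y => by
    by_cases hy : y ∈ Metric.ball x₀ r
    · exact hb y (hrU hy) _ (hfF y hy)
    · rw [hf_def]; simp only [hy, if_false, norm_zero, hM.le]
  set h : ℕ → ℝ := fun k => 1 / ((k : ℝ) + 1) with hh_def
  have hh : ∀ k, 0 < h k := fun k => by positivity
  -- An ultrafilter yields limits at all times simultaneously, replacing the extraction of a
  -- subsequence.
  set l : Ultrafilter ℕ := hyperfilter ℕ
  have hl : Tendsto h l (𝓝 0) :=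
    tendsto_one_div_add_atTop_nhds_zero_nat.mono_left Nat.hyperfilter_le_atTop
  have hzero : ∀ k, eulerCurve f x₀ (h k) 0 = x₀ := fun k => by simp [eulerCurve, eulerPoint]
  have hlimit : ∀ t : ℝ, ∃ a, 0 ≤ t → Tendsto (fun k => eulerCurve f x₀ (h k) t) l (𝓝 a) := by
    intro t
    by_cases ht : 0 ≤ t
    · have hmem : ∀ k, eulerCurve f x₀ (h k) t ∈ Metric.closedBall x₀ (M * (t + 1)) := by
        intro k
        have h1 := norm_eulerCurve_sub_le (x₀ := x₀) (hh k) hM.le hfM le_rfl ht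
        rw [hzero, ← dist_eq_norm] at h1
        refine h1.trans (mul_le_mul_of_nonneg_left ?_ hM.le)
        have : h k ≤ 1 := div_le_one_of_le₀ (by linarith [k.cast_nonneg (α := ℝ)]) (by positivity)
        linarith
      obtain ⟨a, -, ha⟩ := (isCompact_closedBall x₀ (M * (t + 1))).ultrafilter_le_nhds'
        (l.map fun k => eulerCurve f x₀ (h k) t)
        (mem_map.2 (univ_mem' hmem))
      exact ⟨a, fun _ => ha⟩
    · exact ⟨0, fun h => absurd h ht⟩
  choose w hw using hlimit
  have hlip : ∀ s t, 0 ≤ s → s ≤ t → dist (w s) (w t) ≤ M * (t - s) := fun s t hs hst => by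
    rw [dist_comm]
    refine le_of_tendsto_of_tendsto ((hw t (hs.trans hst)).dist (hw s hs))
      (show Tendsto (fun k => M * (t - s + h k)) l (𝓝 (M * (t - s))) by
        simpa using (hl.const_add (t - s)).const_mul M) (Eventually.of_forall fun k => ?_)
    simp only [dist_eq_norm]
    exact norm_eulerCurve_sub_le (hh k) hM.le hfM hs hst
  have hw0 : w 0 = x₀ := tendsto_nhds_unique (hw 0 le_rfl) (by simp [hzero])
  have hlipOn : LipschitzOnWith M.toNNReal w (Ici 0) := by
    refine LipschitzOnWith.of_dist_le_mul fun s hs t ht => ?_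
    rw [Real.coe_toNNReal _ hM.le, Real.dist_eq]
    rcases le_total s t with hst | hst
    · rw [abs_sub_comm, abs_of_nonneg (by linarith)]
      exact hlip s t hs hst
    · rw [abs_of_nonneg (by linarith), dist_comm]
      exact hlip t s ht hst
  -- Up to time `r / 2 / M`, speed `M` covers at most `r / 2`.
  have hball : ∀ t ∈ Icc 0 (r / 2 / M), w t ∈ Metric.ball x₀ r := fun t ht => by
    have h1 := hlip 0 t le_rfl ht.1
    rw [hw0, dist_comm, sub_zero] at h1
    have h2 : M * t ≤ r / 2 := by
      rw [← le_div_iff₀' hM]; exact ht.2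
    exact Metric.mem_ball.2 (by linarith)
  refine ⟨r / 2 / M, by positivity, w, ⟨fun a b ha hb => ?_, fun t ht => ?_, ?_⟩, hw0⟩
  · refine (hlipOn.mono fun t ht => ?_).absolutelyContinuousOnInterval
    exact (ordConnected_Icc.uIcc_subset ha hb ht).1
  · exact (hrU (hball t (interior_subset ht))).2
  · filter_upwards [(ae_restrict_iff' measurableSet_Ici).1
        (hlipOn.ae_differentiableWithinAt_real measurableSet_Ici),
      compl_mem_ae_iff.2 (measure_singleton (0 : ℝ))] with t ht ht0 htI
    have htpos : 0 < t := lt_of_le_of_ne htI.1 (Ne.symm ht0)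
    have hd := ((ht htI.1).differentiableAt (Ici_mem_nhds htpos)).hasDerivAt
    have hwC : w t ∈ H.C := (hrU (hball t htI)).2
    refine ⟨_, ?_, hd⟩
    -- It suffices to place the derivative in each closed thickening of `F (w t)`: this is closed
    -- and convex, and contains `f` near `w t` by upper semicontinuity.
    rw [← (hF_osc.isClosed hwC).closure_eq, Metric.closure_eq_iInter_cthickening]
    refine mem_iInter₂.2 fun η hη => ?_
    obtain ⟨δ, hδ, hsub⟩ := hF_osc.exists_subset_cthickening hwC (hF_bdd _ hwC) hη
    obtain ⟨δ', hδ', hsub'⟩ := Metric.isOpen_iff.1 Metric.isOpen_ball _ (hball t htI)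
    refine deriv_mem_of_tendsto_eulerCurve hM.le hfM hh hl hw htI.1 hd
      ((hF_convex _ hwC).cthickening η) Metric.isClosed_cthickening (lt_min hδ hδ') fun y hy => ?_
    have hyb : y ∈ Metric.ball x₀ r := hsub' (hy.trans_le (min_le_right _ _))
    exact hsub y (hrU hyb).2 (hy.trans_le (min_le_left _ _)) (hfF y hyb)

end HybridSystem

/-! ### Where a maximal solution cannot end. -/

namespace HybridSystem

variable {n : ℕ} {H : HybridSystem n}

theorem HasNontrivialFlowFrom.exists_isFlowOn {x₀ : EuclideanSpace ℝ (Fin n)}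
    (h : H.HasNontrivialFlowFrom x₀) : ∃ ε > 0, ∃ w, H.IsFlowOn (Icc 0 ε) w ∧ w 0 = x₀ := by
  obtain ⟨x, hx, h0, ε, hε, hdom⟩ := h
  exact ⟨ε, hε, fun t => x.val t 0, (hx.isFlowOn 0).mono fun t ht => hdom t ht, h0⟩

/-- A maximal solution whose last interval contains its final time does not end at a point of `C`
from which flow is possible. -/
theorem IsMaximalSolution.not_exists_isFlowOn {x : HybridArc n} (hx : H.IsMaximalSolution x)
    {J : ℕ} (hJ : ∀ p ∈ x.dom, p.2 ≤ J) {T : ℝ} (hT : IsGreatest (x.flowInterval J) T)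
    (hC : x.val T J ∈ H.C) :
    ¬ ∃ ε > 0, ∃ w, H.IsFlowOn (Icc 0 ε) w ∧ w 0 = x.val T J := by
  rintro ⟨ε, hε, w, hw, hw0⟩
  have hI := hx.1.ordConnected J
  have hflow := (hx.1.isFlowOn J).concat hT hI hw hε hw0 hC
  have hsub := hx.subset_flowInterval hJ ⟨T, hT.1⟩ (I := x.flowInterval J ∪ Icc T (T + ε)) ?_
    subset_union_left ?_ hflow ?_
  · have := hT.2 (hsub (Or.inr ⟨by linarith, le_rfl⟩))
    linarith
  · refine ⟨?_⟩
    rintro a (ha | ha) b (hb | hb) u hu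
    · exact Or.inl (hI.out ha hb hu)
    · rcases le_total u T with h | h
      · exact Or.inl (hI.out ha hT.1 ⟨hu.1, h⟩)
      · exact Or.inr ⟨h, hu.2.trans hb.2⟩
    · exact Or.inr ⟨ha.1.trans hu.1, (hu.2.trans (hT.2 hb)).trans (by linarith)⟩
    · exact Or.inr ⟨ha.1.trans hu.1, hu.2.trans hb.2⟩
  · intro t ht htI u hu
    exact (hT.2 hu).trans (ht.resolve_left htI).1
  · intro t ht
    exact if_pos (hT.2 ht)

/-- On a final interval `[t_J, T)` with `T` finite, a maximal solution does not accumulate at a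
point near which `F` is locally bounded. -/
theorem IsMaximalSolution.not_mapClusterPt {x : HybridArc n} (hx : H.IsMaximalSolution x)
    {J : ℕ} (hJ : ∀ p ∈ x.dom, p.2 ≤ J) (hne : (x.flowInterval J).Nonempty) {T : ℝ}
    (hT : IsLUB (x.flowInterval J) T) (hTI : T ∉ x.flowInterval J)
    {p : EuclideanSpace ℝ (Fin n)} (hF : LocallyBoundedWithinAt H.F H.C p) :
    ¬ MapClusterPt p (𝓝[<] T) (fun t => x.val t J) := by
  intro hp
  have hI := hx.1.ordConnected J
  have hflow := (hx.1.isFlowOn J).update_of_mapClusterPt hI hT hTI hne hp hF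
  refine hTI (hx.subset_flowInterval hJ hne ?_ (subset_insert T _) ?_ hflow ?_ (mem_insert T _))
  · refine ⟨?_⟩
    have hmem : ∀ a ∈ x.flowInterval J, ∀ u, a ≤ u → u ≤ T → u ∈ insert T (x.flowInterval J) := by
      intro a ha u hau huT
      rcases huT.eq_or_lt with rfl | hlt
      · exact mem_insert _ _
      · obtain ⟨b, hb, hub⟩ := (lt_isLUB_iff hT).1 hlt
        exact Or.inr (hI.out ha hb ⟨hau, hub.le⟩)
    rintro a (rfl | ha) b (rfl | hb) u hu
    · exact Or.inl (le_antisymm hu.2 hu.1)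
    · exact Or.inl (le_antisymm (hu.2.trans (hT.1 hb)) hu.1)
    · exact hmem a ha u hu.1 hu.2
    · exact hmem a ha u hu.1 (hu.2.trans (hT.1 hb))
  · rintro t (rfl | ht) htI u hu
    · exact hT.1 hu
    · exact absurd ht htI
  · intro t ht
    exact Function.update_of_ne (ne_of_mem_of_not_mem ht hTI) _ _

end HybridSystem

/-! ### Completeness of maximal solutions from `K`. -/

theorem proposition2 {n : ℕ} (H : HybridSystem n) (K : Set (EuclideanSpace ℝ (Fin n)))
    (hF_osc : OuterSemicontinuousOn H.F H.C)
    (hF_bdd : ∀ x ∈ H.C ∪ (K ∩ frontier H.C), LocallyBoundedWithinAt H.F H.C x)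
    (hF_nonempty : ∀ x ∈ H.C, (H.F x).Nonempty)
    (hF_convex : ∀ x ∈ H.C, Convex ℝ (H.F x))
    (hG_nonempty : ∀ x ∈ H.D, (H.G x).Nonempty)
    (hK_closed : IsClosed K)
    (hK_subset : K ⊆ H.C ∪ H.D)
    (hK_pre : H.IsForwardPreInvariant K)
    (h_escape : ∀ x : HybridArc n, H.IsSolution x → x.val 0 0 ∈ K →
      ¬ x.EscapesInFiniteTimeInside (K ∩ H.C))
    (h_flow : ∀ x₀ ∈ (K ∩ frontier H.C) \ H.D, H.HasNontrivialFlowFrom x₀) :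
    H.IsForwardInvariant K := by
  refine ⟨hK_pre, fun x hx hx0 hbdd => ?_⟩
  have hK := hK_pre x hx hx0
  obtain ⟨J, hJ_mem, hJ⟩ : ∃ J, (x.flowInterval J).Nonempty ∧ ∀ p ∈ x.dom, p.2 ≤ J := by
    have hb : BddAbove (Prod.snd '' x.dom) := hbdd.image_snd.bddAbove
    obtain ⟨p, hp, hpJ⟩ := Nat.sSup_mem ⟨0, mem_image_of_mem Prod.snd hx.1.zero_mem⟩ hb
    exact ⟨p.2, ⟨p.1, hp⟩, fun q hq => hpJ ▸ le_csSup hb (mem_image_of_mem _ hq)⟩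
  have hIb : BddAbove (x.flowInterval J) :=
    hbdd.image_fst.bddAbove.mono fun t ht => mem_image_of_mem Prod.fst ht
  obtain ⟨T, hT⟩ : ∃ T, IsLUB (x.flowInterval J) T := ⟨_, isLUB_csSup hJ_mem hIb⟩
  by_cases hTI : T ∈ x.flowInterval J
  · have hmax : ∀ p ∈ x.dom, p ≤ (T, J) := by
      rintro ⟨t, j⟩ hp
      refine ⟨?_, hJ _ hp⟩
      rcases (hJ _ hp).eq_or_lt with h | h
      · obtain rfl : j = J := h
        exact hT.1 hp
      · exact hx.1.isHybridTimeDomain.le_of_lt hTI hp h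
    have hD := hx.notMem_of_isGreatest hTI hmax hG_nonempty
    have hKT : x.val T J ∈ K := hK (T, J) hTI
    have hC : x.val T J ∈ H.C := (hK_subset hKT).resolve_right hD
    refine hx.not_exists_isFlowOn hJ ⟨hTI, hT.1⟩ hC ?_
    by_cases hint : x.val T J ∈ interior H.C
    · exact HybridSystem.exists_isFlowOn_of_mem_interior hF_osc
        (fun y hy => hF_bdd y (Or.inl hy)) hF_nonempty hF_convex hint
    · exact (h_flow _ ⟨⟨hKT, subset_closure hC, hint⟩, hD⟩).exists_isFlowOn
  · obtain ⟨s, hs⟩ := hJ_mem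
    have hsT : s < T := lt_of_le_of_ne (hT.1 hs) fun e => hTI (e ▸ hs)
    have hI : ∀ t ∈ Ico s T, t ∈ x.flowInterval J := fun t ht => by
      obtain ⟨u, hu, htu⟩ := (lt_isLUB_iff hT).1 ht.2
      exact (hx.1.ordConnected J).out hs hu ⟨ht.1, htu.le⟩
    have hKC : ∀ t ∈ Ioo s T, x.val t J ∈ K ∩ H.C := fun t ht =>
      ⟨hK (t, J) (hI t ⟨ht.1.le, ht.2⟩), (hx.1.isFlowOn J).mem t
        (mem_interior_iff_mem_nhds.2 (mem_of_superset (isOpen_Ioo.mem_nhds ht)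
          fun u hu => hI u ⟨hu.1.le, hu.2⟩))⟩
    have hnot : ¬ Tendsto (fun t => ‖x.val t J‖) (𝓝[<] T) atTop := fun hlim => by
      -- Starting at the midpoint avoids `s`, which may be the left end of `I^J`, where membership
      -- in `C` is not guaranteed.
      refine h_escape x hx.1 hx0 ⟨J, (s + T) / 2, T, by linarith, fun t ht => ?_, hlim⟩
      have ht' : t ∈ Ioo s T := ⟨by linarith [ht.1], ht.2⟩
      exact ⟨hI t ⟨ht'.1.le, ht'.2⟩, hKC t ht'⟩
    rw [tendsto_atTop] at hnot
    push Not at hnot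
    obtain ⟨R, hR⟩ := hnot
    -- The closure of `C` makes the set compact; a cluster point outside `C` is then on its
    -- frontier, where local boundedness is also assumed.
    have hfreq : ∃ᶠ t in 𝓝[<] T,
        x.val t J ∈ Metric.closedBall (0 : EuclideanSpace ℝ (Fin n)) R ∩ (K ∩ closure H.C) := by
      refine (hR.and_eventually (Ioo_mem_nhdsLT hsT)).mono ?_
      rintro t ⟨ht, htI⟩
      exact ⟨mem_closedBall_zero_iff.2 ht.le, (hKC t htI).1, subset_closure (hKC t htI).2⟩
    obtain ⟨p, ⟨-, hpK, hpC⟩, hp⟩ := ((isCompact_closedBall _ R).inter_right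
      (hK_closed.inter isClosed_closure)).exists_mapClusterPt_of_frequently hfreq
    refine hx.not_mapClusterPt hJ ⟨s, hs⟩ hT hTI (hF_bdd p ?_) hp
    by_cases h : p ∈ H.C
    · exact Or.inl h
    · exact Or.inr ⟨hpK, hpC, fun hint => h (interior_subset hint)⟩
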